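/- Let $C^1([0,1])$ be the Banach algebra of all continuously differentiable functions $f\colon[0,1]\to\mathbb{C}$ (one-sided derivatives at the endpoints), with pointwise operations and the norm $\|f\|=\sup_{[0,1]}|f|+\sup_{[0,1]}|f'|$. Let $\varphi\colon C^1([0,1])\to\mathbb{C}$ be a (not necessarily linear or continuous) multiplicative spectral function, that is, $\varphi(fg)=\varphi(f)\varphi(g)$ for all $f,g\in C^1([0,1])$ and $\varphi(f)\in\sigma(f)$ for every $f\in C^1([0,1])$, where $\sigma(f)$ is the spectrum of $f$ in $C^1([0,1])$. Then the following statements are equivalent: (i) $\varphi$ is a character, i.e. a nonzero multiplicative linear functional; (ii) $\varphi$ is continuous (with respect to the norm above); (iii) $1\notin\operatorname{span}(\ker\varphi)$, where $\ker\varphi=\{f\in C^1([0,1]):\varphi(f)=0\}$ and $\operatorname{span}$ is the complex linear span. -/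

import Mathlib

noncomputable section

/-- The subalgebra of `C([0,1])` (complex-valued functions) consisting of the continuously
differentiable functions on `[0,1]`, with one-sided derivatives at the endpoints.
A function on the subtype `[0,1]` is extended to `ℝ` so that differentiability *within*
`[0,1]` can be expressed; only the values on `[0,1]` matter. -/
def c1Subalgebra : Subalgebra ℂ C(unitInterval, ℂ) where
  carrier := {f | ContDiffOn ℝ 1 (Set.IccExtend (zero_le_one' ℝ) f) (Set.Icc 0 1)}
  mul_mem' {_ _} hf hg := ContDiffOn.mul hf hg
  add_mem' {_ _} hf hg := ContDiffOn.add hf hg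
  algebraMap_mem' r := (contDiff_const (c := r)).contDiffOn

/-- The algebra `C¹([0,1])` of continuously differentiable functions `[0,1] → ℂ`. It is a type of
its own, so that it carries the `C¹` norm below and not the supremum norm of `C([0,1])`. -/
def C1Interval : Type := c1Subalgebra

namespace C1Interval

instance : CommRing C1Interval := inferInstanceAs (CommRing c1Subalgebra)

instance : Algebra ℂ C1Interval := inferInstanceAs (Algebra ℂ c1Subalgebra)

/-- The inclusion of `C¹([0,1])` into `C([0,1])`. -/
def toContinuousMap : C1Interval →ₐ[ℂ] C(unitInterval, ℂ) := c1Subalgebra.val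

theorem toContinuousMap_injective : Function.Injective toContinuousMap :=
  Subtype.val_injective

/-- The extension to `ℝ` of a function of class `C¹` on `[0,1]`, constant on each side
of `[0,1]`. -/
def extend (f : C1Interval) : ℝ → ℂ := Set.IccExtend (zero_le_one' ℝ) (toContinuousMap f)

theorem contDiffOn_extend (f : C1Interval) : ContDiffOn ℝ 1 f.extend (Set.Icc 0 1) := f.2

theorem extend_coe (f : C1Interval) (x : unitInterval) :
    f.extend (x : ℝ) = toContinuousMap f x :=
  Set.IccExtend_val _ _ x

theorem differentiableWithinAt_extend (f : C1Interval) (x : unitInterval) :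
    DifferentiableWithinAt ℝ f.extend (Set.Icc 0 1) (x : ℝ) :=
  (f.contDiffOn_extend.differentiableOn one_ne_zero) x x.2

/-- The derivative `f'` of `f ∈ C¹([0,1])` (one-sided at the endpoints), an element
of `C([0,1])`. -/
def derivative (f : C1Interval) : C(unitInterval, ℂ) where
  toFun x := derivWithin f.extend (Set.Icc 0 1) (x : ℝ)
  continuous_toFun := continuousOn_iff_continuous_domRestrict.mp
    (f.contDiffOn_extend.continuousOn_derivWithin uniqueDiffOn_Icc_zero_one le_rfl)

theorem derivative_add (f g : C1Interval) :
    (f + g).derivative = f.derivative + g.derivative := by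
  ext x
  exact derivWithin_add (f.differentiableWithinAt_extend x) (g.differentiableWithinAt_extend x)

theorem derivative_smul (c : ℂ) (f : C1Interval) :
    (c • f).derivative = c • f.derivative := by
  ext x
  exact derivWithin_const_smul c (f.differentiableWithinAt_extend x)

theorem derivative_mul (f g : C1Interval) :
    (f * g).derivative =
      f.derivative * toContinuousMap g + toContinuousMap f * g.derivative := by
  ext x
  have h := derivWithin_mul (f.differentiableWithinAt_extend x)
    (g.differentiableWithinAt_extend x)
  rw [extend_coe, extend_coe] at h
  exact h

theorem derivative_neg (f : C1Interval) : (-f).derivative = -f.derivative := by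
  ext x
  exact derivWithin.neg

theorem derivative_zero : (0 : C1Interval).derivative = 0 := by
  simpa using derivative_add 0 0

/-- The norm `‖f‖ = sup |f| + sup |f'|` on `C¹([0,1])`. -/
instance : Norm C1Interval := ⟨fun f => ‖toContinuousMap f‖ + ‖f.derivative‖⟩

theorem norm_def (f : C1Interval) : ‖f‖ = ‖toContinuousMap f‖ + ‖f.derivative‖ := rfl

instance : NormedAddCommGroup C1Interval :=
  AddGroupNorm.toNormedAddCommGroup
    { toFun := fun f => ‖f‖
      map_zero' := by simp [norm_def, derivative_zero]
      add_le' := fun f g => by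
        rw [norm_def, norm_def, norm_def, map_add, derivative_add]
        linarith [norm_add_le (toContinuousMap f) (toContinuousMap g),
          norm_add_le f.derivative g.derivative]
      neg' := fun f => by rw [norm_def, norm_def, map_neg, derivative_neg, norm_neg, norm_neg]
      eq_zero_of_map_eq_zero' := fun f hf => by
        have h : ‖toContinuousMap f‖ = 0 := by
          have h1 : ‖toContinuousMap f‖ + ‖f.derivative‖ = 0 := hf
          linarith [norm_nonneg (toContinuousMap f), norm_nonneg f.derivative]
        exact toContinuousMap_injective (by rw [norm_eq_zero.mp h, map_zero]) }

instance : NormedCommRing C1Interval :=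
  { (inferInstance : NormedAddCommGroup C1Interval),
    (inferInstance : CommRing C1Interval) with
    norm_mul_le := fun f g => by
      rw [norm_def, norm_def, norm_def, map_mul, derivative_mul]
      have h1 := norm_mul_le (toContinuousMap f) (toContinuousMap g)
      have h2 := norm_add_le (f.derivative * toContinuousMap g)
        (toContinuousMap f * g.derivative)
      have h3 := norm_mul_le f.derivative (toContinuousMap g)
      have h4 := norm_mul_le (toContinuousMap f) g.derivative
      have h5 : 0 ≤ ‖f.derivative‖ * ‖g.derivative‖ := by positivity
      nlinarith }

instance : NormedAlgebra ℂ C1Interval where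
  norm_smul_le c f := by
    rw [norm_def, norm_def, map_smul, derivative_smul, norm_smul, norm_smul, mul_add]

end C1Interval

/-- A (not necessarily linear or continuous) function `φ : A → ℂ` on a complex algebra is a
multiplicative spectral function if it is multiplicative and `φ a` lies in the spectrum of `a`
for every `a`. -/
structure IsMultiplicativeSpectral {A : Type*} [Ring A] [Algebra ℂ A] (φ : A → ℂ) : Prop where
  map_mul : ∀ a b : A, φ (a * b) = φ a * φ b
  mem_spectrum : ∀ a : A, φ a ∈ spectrum ℂ a

/-- A function `φ : A → ℂ` on a unital complex algebra is a character if it is a nonzero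
multiplicative linear functional, i.e. a unital algebra homomorphism. -/
def IsCharacter {A : Type*} [Ring A] [Algebra ℂ A] (φ : A → ℂ) : Prop :=
  ∃ ψ : A →ₐ[ℂ] ℂ, ∀ a : A, φ a = ψ a

end

/-! On invertible functions, `φ` is evaluation at a single point `x₀`: elements of the spectrum are
values of the function, and test functions with injective modulus or argument pin down where the
value is taken (`exists_forall_isUnit`). It remains to reach functions with zeros. If `φ` is
continuous, `f - c` is invertible for a dense set of `c`, and the formula passes to the limit. If
`1` is not in the span of the kernel, `φ` depends only on the germ at `x₀`; flattening `f` away from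
`x₀` then puts its whole range, hence `φ f`, near `f x₀`. -/

namespace C1Interval

/-- Restriction to `[0,1]` of a function on `ℝ` which is `C¹` there. -/
def ofContDiffOn (F : ℝ → ℂ) (hF : ContDiffOn ℝ 1 F (Set.Icc 0 1)) : C1Interval :=
  ⟨⟨fun x => F x, continuousOn_iff_continuous_domRestrict.mp hF.continuousOn⟩,
    hF.congr fun _ hx => Set.IccExtend_of_mem _ _ hx⟩

@[simp]
theorem toContinuousMap_ofContDiffOn (F : ℝ → ℂ) (hF : ContDiffOn ℝ 1 F (Set.Icc 0 1))
    (x : unitInterval) : toContinuousMap (ofContDiffOn F hF) x = F x := rfl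

theorem ext_apply {f g : C1Interval}
    (h : ∀ x, toContinuousMap f x = toContinuousMap g x) : f = g :=
  toContinuousMap_injective (ContinuousMap.ext h)

@[simp]
theorem toContinuousMap_algebraMap (c : ℂ) (x : unitInterval) :
    toContinuousMap (algebraMap ℂ C1Interval c) x = c := by
  rw [AlgHom.commutes]; rfl

theorem extend_ne_zero {f : C1Interval} (h : ∀ x, toContinuousMap f x ≠ 0) :
    ∀ x ∈ Set.Icc (0 : ℝ) 1, f.extend x ≠ 0 := fun x hx => by
  simpa only [extend_coe] using (extend_coe f ⟨x, hx⟩).trans_ne (h ⟨x, hx⟩)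

theorem isUnit_of_ne_zero {f : C1Interval} (h : ∀ x, toContinuousMap f x ≠ 0) : IsUnit f := by
  refine IsUnit.of_mul_eq_one
    (ofContDiffOn (fun x => (f.extend x)⁻¹) (f.contDiffOn_extend.inv (extend_ne_zero h))) ?_
  refine ext_apply fun x => ?_
  simp [extend_coe, h x]

theorem exists_apply_eq_of_mem_spectrum {f : C1Interval} {c : ℂ} (hc : c ∈ spectrum ℂ f) :
    ∃ x, toContinuousMap f x = c := by
  by_contra! h
  refine hc (isUnit_of_ne_zero fun x => ?_)
  rw [map_sub, ContinuousMap.sub_apply, toContinuousMap_algebraMap, sub_ne_zero]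
  exact (h x).symm

/-- A `C¹` cutoff function at `x₀`: it is `1` on `closedBall x₀ (r / 2)`, vanishes
outside `ball x₀ r`, and takes values in `[0,1]`. -/
theorem exists_cutoff (x₀ : unitInterval) {r : ℝ} (hr : 0 < r) :
    ∃ (χ : C1Interval) (b : unitInterval → ℝ), (∀ x, toContinuousMap χ x = b x) ∧
      (∀ x, 0 ≤ b x) ∧ (∀ x, b x ≤ 1) ∧ (∀ x, dist x x₀ ≤ r / 2 → b x = 1) ∧
      ∀ x, r ≤ dist x x₀ → b x = 0 := by
  let B : ContDiffBump (x₀ : ℝ) := ⟨r / 2, r, by positivity, by linarith⟩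
  have hB : ContDiff ℝ 1 (fun x : ℝ => (B x : ℂ)) :=
    Complex.ofRealCLM.contDiff.comp B.contDiff
  exact ⟨ofContDiffOn _ hB.contDiffOn, fun x => B x, fun x => rfl, fun x => B.nonneg,
    fun x => B.le_one, fun x hx => B.one_of_mem_closedBall hx,
    fun x hx => B.zero_of_le_dist hx⟩

/-- A `C¹` curve has range of Hausdorff dimension at most 1, so its complement is dense in the
plane. -/
theorem dense_isUnit_sub_algebraMap (f : C1Interval) :
    Dense {c : ℂ | IsUnit (f - algebraMap ℂ C1Interval c)} := by
  have h := f.contDiffOn_extend.dense_compl_image_of_dimH_lt_finrank (convex_Icc 0 1)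
    subset_rfl (by
      refine (dimH_mono (Set.subset_univ _)).trans_lt ?_
      rw [Real.dimH_univ, Complex.finrank_real_complex]
      norm_num)
  refine h.mono fun c hc => ?_
  refine isUnit_of_ne_zero fun x hx => hc ⟨x, x.2, ?_⟩
  rw [map_sub, ContinuousMap.sub_apply, toContinuousMap_algebraMap, sub_eq_zero] at hx
  rw [extend_coe, hx]

end C1Interval

namespace IsCharacter

open C1Interval

variable {φ : C1Interval → ℂ}

theorem continuous (h : IsCharacter φ) : Continuous φ := by
  obtain ⟨ψ, hψ⟩ := h
  obtain rfl : φ = ψ := funext hψ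
  refine AddMonoidHomClass.continuous_of_bound ψ 1 fun f => ?_
  obtain ⟨x, hx⟩ := exists_apply_eq_of_mem_spectrum (AlgHom.apply_mem_spectrum ψ f)
  rw [← hx, one_mul, norm_def]
  exact ((toContinuousMap f).norm_coe_le_norm x).trans (le_add_of_nonneg_right (norm_nonneg _))

theorem one_notMem_span_ker (h : IsCharacter φ) :
    (1 : C1Interval) ∉ Submodule.span ℂ {f : C1Interval | φ f = 0} := by
  obtain ⟨ψ, hψ⟩ := h
  intro h1
  have hle : Submodule.span ℂ {f : C1Interval | φ f = 0} ≤ LinearMap.ker ψ.toLinearMap :=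
    Submodule.span_le.mpr fun f hf => by
      have hf' : φ f = 0 := hf
      simpa [hψ] using hf'
  simpa using hle h1

theorem of_eq_apply (x₀ : unitInterval) (h : ∀ f, φ f = toContinuousMap f x₀) :
    IsCharacter φ :=
  ⟨(ContinuousMap.evalAlgHom ℂ ℂ x₀).comp toContinuousMap, h⟩

end IsCharacter

namespace IsMultiplicativeSpectral

open C1Interval

variable {φ : C1Interval → ℂ}

theorem exists_apply_eq (hφ : IsMultiplicativeSpectral φ) (f : C1Interval) :
    ∃ x, φ f = toContinuousMap f x :=
  (exists_apply_eq_of_mem_spectrum (hφ.mem_spectrum f)).imp fun _ h => h.symm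

/-- On the invertible functions, a multiplicative spectral function is a point evaluation. -/
theorem exists_forall_isUnit (hφ : IsMultiplicativeSpectral φ) :
    ∃ x₀ : unitInterval, ∀ f : C1Interval, IsUnit f → φ f = toContinuousMap f x₀ := by
  -- The modulus of `e` is injective, so `|φ (e * u)|` locates the point when `u` is unimodular.
  let e : C1Interval := ofContDiffOn (fun x => 1 + (x : ℂ))
    (contDiff_const.add Complex.ofRealCLM.contDiff).contDiffOn
  have he (x : unitInterval) : toContinuousMap e x = ((1 + x : ℝ) : ℂ) := by
    push_cast; rfl
  -- The argument of `w` is injective since `[0,1]` lies in `(-π, π]`; it locates the point for `p *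
  -- w` with `p` positive.
  let w : C1Interval := ofContDiffOn (fun x => Complex.exp ((x : ℂ) * Complex.I))
    (Complex.ofRealCLM.contDiff.mul contDiff_const).cexp.contDiffOn
  have hw (x : unitInterval) : toContinuousMap w x = Complex.exp ((x : ℝ) * Complex.I) := rfl
  obtain ⟨x₀, hx₀⟩ := hφ.exists_apply_eq e
  have unimodular (u : C1Interval) (hu : ∀ x, ‖toContinuousMap u x‖ = 1) :
      φ u = toContinuousMap u x₀ := by
    obtain ⟨y, hy⟩ := hφ.exists_apply_eq (e * u)
    obtain ⟨z, hz⟩ := hφ.exists_apply_eq u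
    rw [hφ.map_mul, hx₀, _root_.map_mul, ContinuousMap.mul_apply, he, he] at hy
    have hn := congrArg norm hy
    rw [norm_mul, norm_mul, hz, hu, hu, Complex.norm_real, Complex.norm_real,
      Real.norm_of_nonneg (by linarith [x₀.2.1]), Real.norm_of_nonneg (by linarith [y.2.1])] at hn
    obtain rfl : x₀ = y := Subtype.ext (by linarith)
    refine mul_left_cancel₀ ?_ hy
    exact Complex.ofReal_ne_zero.mpr (by linarith [x₀.2.1])
  have positive (p : C1Interval) (b : unitInterval → ℝ) (hp : ∀ x, toContinuousMap p x = b x)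
      (hb : ∀ x, 0 < b x) : φ p = toContinuousMap p x₀ := by
    obtain ⟨y, hy⟩ := hφ.exists_apply_eq (p * w)
    obtain ⟨z, hz⟩ := hφ.exists_apply_eq p
    rw [hφ.map_mul, unimodular w fun x => by rw [hw, Complex.norm_exp_ofReal_mul_I],
      _root_.map_mul,
      ContinuousMap.mul_apply, hz, hp, hp] at hy
    have hn := congrArg norm hy
    rw [norm_mul, norm_mul, hw, hw, Complex.norm_exp_ofReal_mul_I, Complex.norm_exp_ofReal_mul_I,
      Complex.norm_real, Complex.norm_real, Real.norm_of_nonneg (hb _).le,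
      Real.norm_of_nonneg (hb _).le, mul_one, mul_one] at hn
    rw [hn] at hy
    have hexp := mul_left_cancel₀ (Complex.ofReal_ne_zero.mpr (hb y).ne') hy
    have harg := congrArg Complex.arg hexp
    have hpi := Real.pi_gt_three
    rw [hw, hw, Complex.arg_exp_mul_I, Complex.arg_exp_mul_I,
      (toIocMod_eq_self _).mpr ⟨by linarith [x₀.2.1], by linarith [x₀.2.2]⟩,
      (toIocMod_eq_self _).mpr ⟨by linarith [y.2.1], by linarith [y.2.2]⟩] at harg
    obtain rfl : x₀ = y := Subtype.ext harg
    rw [hz, hp, hn, hp]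
  refine ⟨x₀, fun f hf => ?_⟩
  have hne (x : unitInterval) : toContinuousMap f x ≠ 0 :=
    (hf.map ((ContinuousMap.evalAlgHom ℂ ℂ x).comp toContinuousMap)).ne_zero
  have hN : ContDiffOn ℝ 1 (fun x => (‖f.extend x‖ : ℂ)) (Set.Icc 0 1) :=
    Complex.ofRealCLM.contDiff.comp_contDiffOn
      (f.contDiffOn_extend.norm ℝ (extend_ne_zero hne))
  -- Polar decomposition `f = u * p`, of class `C¹` because `f` has no zeros.
  let p : C1Interval := ofContDiffOn _ hN
  let u : C1Interval := ofContDiffOn _ (f.contDiffOn_extend.mul (hN.inv fun x hx =>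
    Complex.ofReal_ne_zero.mpr (norm_ne_zero_iff.mpr (extend_ne_zero hne x hx))))
  have hpx (x : unitInterval) : toContinuousMap p x = (‖toContinuousMap f x‖ : ℝ) := by
    simp [p, extend_coe]
  have hux (x : unitInterval) :
      toContinuousMap u x = toContinuousMap f x * ((‖toContinuousMap f x‖ : ℝ) : ℂ)⁻¹ := by
    simp [u, extend_coe]
  have hfup : f = u * p := ext_apply fun x => by
    rw [_root_.map_mul, ContinuousMap.mul_apply, hpx, hux, inv_mul_cancel_right₀]
    exact Complex.ofReal_ne_zero.mpr (norm_ne_zero_iff.mpr (hne x))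
  have hu1 (x : unitInterval) : ‖toContinuousMap u x‖ = 1 := by
    rw [hux, norm_mul, norm_inv, Complex.norm_real, norm_norm,
      mul_inv_cancel₀ (norm_ne_zero_iff.mpr (hne x))]
  rw [hfup, hφ.map_mul, unimodular u hu1, positive p _ hpx fun x => norm_pos_iff.mpr (hne x),
    _root_.map_mul, ContinuousMap.mul_apply]

theorem isCharacter_of_continuous (hφ : IsMultiplicativeSpectral φ) (hc : Continuous φ) :
    IsCharacter φ := by
  obtain ⟨x₀, hx₀⟩ := hφ.exists_forall_isUnit
  refine .of_eq_apply x₀ fun f => ?_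
  have h : (fun c : ℂ => φ (f - algebraMap ℂ C1Interval c)) =
      fun c => toContinuousMap f x₀ - c := by
    refine Continuous.ext_on (dense_isUnit_sub_algebraMap f) ?_ (by fun_prop) fun c hcu => ?_
    · exact hc.comp (continuous_const.sub (continuous_algebraMap ℂ C1Interval))
    · simpa using hx₀ _ hcu
  simpa using congrFun h 0

/-- If `1` is not in the span of the kernel, then `φ` does not vanish on the cutoff functions at
the point it determines, hence is local there. -/
theorem isCharacter_of_one_notMem_span_ker (hφ : IsMultiplicativeSpectral φ)
    (h1 : (1 : C1Interval) ∉ Submodule.span ℂ {f : C1Interval | φ f = 0}) :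
    IsCharacter φ := by
  obtain ⟨x₀, hx₀⟩ := hφ.exists_forall_isUnit
  -- With `χ` supported where `h` vanishes, `h * (1 + χ) = h` while `φ (1 + χ) = 2`, so `φ h = 2 * φ
  -- h`.
  have vanish (h : C1Interval) (r : ℝ) (hr : 0 < r)
      (hh : ∀ x, dist x x₀ ≤ r → toContinuousMap h x = 0) : φ h = 0 := by
    obtain ⟨χ, b, hχ, hb0, -, hb1, hbr⟩ := exists_cutoff x₀ hr
    have hunit : IsUnit (1 + χ) := isUnit_of_ne_zero fun x => by
      rw [map_add, map_one, ContinuousMap.add_apply, ContinuousMap.one_apply, hχ]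
      exact_mod_cast (add_pos_of_pos_of_nonneg one_pos (hb0 x)).ne'
    have hmul : h * (1 + χ) = h := ext_apply fun x => by
      rcases le_total (dist x x₀) r with hx | hx
      · simp [hh x hx]
      · simp [hχ, hbr x hx]
    have h2 := hφ.map_mul h (1 + χ)
    rw [hmul, hx₀ _ hunit, map_add, map_one, ContinuousMap.add_apply, ContinuousMap.one_apply, hχ,
      hb1 x₀ (by rw [dist_self]; positivity)] at h2
    push_cast at h2
    linear_combination -h2
  refine .of_eq_apply x₀ fun f => ?_
  refine eq_of_forall_dist_le fun ε hε => ?_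
  obtain ⟨r, hr, hfr⟩ := Metric.continuous_iff.mp (toContinuousMap f).continuous x₀ ε hε
  obtain ⟨χ, b, hχ, hb0, hb_le, hb1, hbr⟩ := exists_cutoff x₀ hr
  obtain ⟨χ', b', hχ', -, -, hb1', hbr'⟩ := exists_cutoff x₀ (half_pos hr)
  -- Otherwise `χ'` and `1 - χ'`, which vanishes near `x₀`, both lie in the kernel and sum to `1`.
  have hne : φ χ' ≠ 0 := fun h0 => by
    refine h1 ?_
    have hmem : φ (1 - χ') = 0 := vanish _ (r / 2 / 2) (by positivity) fun x hx => by
      simp [hχ', hb1' x hx]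
    rw [← add_sub_cancel χ' 1]
    exact add_mem (Submodule.subset_span h0) (Submodule.subset_span hmem)
  let c := toContinuousMap f x₀
  -- `g` agrees with `f` where `χ = 1`, hence on the support of `χ'`, and all its values are within
  -- `ε` of `c`.
  let g : C1Interval := algebraMap ℂ C1Interval c + χ * (f - algebraMap ℂ C1Interval c)
  have hg (x : unitInterval) : toContinuousMap g x = c + b x * (toContinuousMap f x - c) := by
    simp [g, hχ]
  have hfg : f * χ' = g * χ' := ext_apply fun x => by
    rw [_root_.map_mul, _root_.map_mul, ContinuousMap.mul_apply, ContinuousMap.mul_apply, hg, hχ']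
    rcases le_total (dist x x₀) (r / 2) with hx | hx
    · simp [hb1 x hx]
    · simp [hbr' x hx]
  have hφfg : φ f = φ g := mul_right_cancel₀ hne (by rw [← hφ.map_mul, ← hφ.map_mul, hfg])
  obtain ⟨y, hy⟩ := hφ.exists_apply_eq g
  rw [hφfg, hy, hg, dist_eq_norm, add_sub_cancel_left, norm_mul, Complex.norm_real,
    Real.norm_of_nonneg (hb0 y)]
  rcases lt_or_ge (dist y x₀) r with hyr | hyr
  · have := hfr y hyr
    rw [dist_eq_norm] at this
    calc b y * ‖toContinuousMap f y - c‖ ≤ 1 * ‖toContinuousMap f y - c‖ := by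
          gcongr; exact hb_le y
      _ ≤ ε := by rw [one_mul]; exact this.le
  · rw [hbr y hyr, zero_mul]; exact hε.le

end IsMultiplicativeSpectral

theorem corollary3p11 (φ : C1Interval → ℂ) (hφ : IsMultiplicativeSpectral φ) :
    List.TFAE
      [IsCharacter φ,
       Continuous φ,
       (1 : C1Interval) ∉ Submodule.span ℂ {f : C1Interval | φ f = 0}] := by
  tfae_have 1 → 2 := IsCharacter.continuous
  tfae_have 1 → 3 := IsCharacter.one_notMem_span_ker
  tfae_have 2 → 1 := hφ.isCharacter_of_continuous
  tfae_have 3 → 1 := hφ.isCharacter_of_one_notMem_span_ker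
  tfae_finish
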